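/- Let $n\ge 2$. A closed bounded set $K\subset\mathbb R^n$ is a star body if the origin is an interior point of $K$, every straight line through the origin meets the boundary of $K$ in exactly two points, and the Minkowski functional $\|x\|_K=\min\{s\ge 0:\ x\in sK\}$ is a continuous function on $\mathbb R^n$; it is origin-symmetric if $-K=K$. A function $g:\mathbb R^n\to\mathbb C$ is positive definite if for all finite sequences $x_1,\dots,x_m\in\mathbb R^n$ and $c_1,\dots,c_m\in\mathbb C$ one has $\sum_{i,j=1}^m c_i\overline{c_j}\,g(x_i-x_j)\ge 0$. **Theorem.** Let $K$ be an origin-symmetric star body in $\mathbb R^n$, $n\ge 2$, and suppose that there exists an even, continuous, non-constant function $f:\mathbb R\to\mathbb R$ such that $f(\|\cdot\|_K)$ is positive definite on $\mathbb R^n$. Then the space $(\mathbb R^n,\|\cdot\|_K)$ embeds in $L_0$, that is, there exist a finite (nonnegative) Borel measure $\mu$ on the unit sphere $S^{n-1}$ and a constant $C\in\mathbb R$ such that for every $x\in\mathbb R^n\setminus\{0\}$ the function $\xi\mapsto\ln|(x,\xi)|$ is finite $\mu$-almost everywhere and $\mu$-integrable, and $$\ln\|x\|_K=\int_{S^{n-1}}\ln|(x,\xi)|\,d\mu(\xi)+C,$$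 where $(x,\xi)$ denotes the Euclidean inner product. -/

import Mathlib

open MeasureTheory
open scoped ComplexOrder InnerProductSpace

/-- A star body in `ℝⁿ`: a closed bounded set with the origin in its interior, such that every
straight line through the origin meets the boundary in exactly two points and the Minkowski
functional `gauge K` (for such a set, `gauge K x = min {s ≥ 0 | x ∈ s • K}`) is continuous. -/
structure IsStarBody {n : ℕ} (K : Set (EuclideanSpace ℝ (Fin n))) : Prop where
  isClosed : IsClosed K
  isBounded : Bornology.IsBounded K
  zero_mem_interior : (0 : EuclideanSpace ℝ (Fin n)) ∈ interior K
  line_inter_frontier : ∀ v : EuclideanSpace ℝ (Fin n), v ≠ 0 →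
    (((ℝ ∙ v : Submodule ℝ (EuclideanSpace ℝ (Fin n))) : Set (EuclideanSpace ℝ (Fin n))) ∩
      frontier K).ncard = 2
  continuous_gauge : Continuous (gauge K)

/-- A set is origin-symmetric if it is stable under `x ↦ -x`. -/
def IsOriginSymmetric {n : ℕ} (K : Set (EuclideanSpace ℝ (Fin n))) : Prop :=
  ∀ x ∈ K, -x ∈ K

/-- Positive definite complex-valued functions on `ℝⁿ`. In the order used on `ℂ`, `0 ≤ z` means
that `z` is real and nonnegative. -/
def IsPosDefFun {n : ℕ} (g : EuclideanSpace ℝ (Fin n) → ℂ) : Prop :=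
  ∀ (m : ℕ) (x : Fin m → EuclideanSpace ℝ (Fin n)) (c : Fin m → ℂ),
    0 ≤ ∑ i, ∑ j, c i * (starRingEnd ℂ) (c j) * g (x i - x j)

/-- The space `(ℝⁿ, N)` embeds in `L₀`: for some finite Borel measure `μ` on the unit sphere and
some constant `C`, `ln N(x) = ∫ ln |(x, ξ)| dμ(ξ) + C`. Here `ln 0 = -∞`, while `Real.log 0 = 0`.
So for `x ≠ 0`, where the left side is finite, the convergence of the integral is spelled out:
`(x, ξ) ≠ 0` for `μ`-almost every `ξ`, and `ln |(x, ξ)|` is integrable. The point `x = 0`, where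
both sides are `-∞`, is left out. -/
def EmbedsInL0 {n : ℕ} (N : EuclideanSpace ℝ (Fin n) → ℝ) : Prop :=
  ∃ (μ : Measure (Metric.sphere (0 : EuclideanSpace ℝ (Fin n)) 1)) (C : ℝ),
    IsFiniteMeasure μ ∧
    ∀ x : EuclideanSpace ℝ (Fin n), x ≠ 0 →
      (∀ᵐ ξ : Metric.sphere (0 : EuclideanSpace ℝ (Fin n)) 1 ∂μ,
        ⟪x, (ξ : EuclideanSpace ℝ (Fin n))⟫_ℝ ≠ 0) ∧
      Integrable (fun ξ : Metric.sphere (0 : EuclideanSpace ℝ (Fin n)) 1 =>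
        Real.log |⟪x, (ξ : EuclideanSpace ℝ (Fin n))⟫_ℝ|) μ ∧
      Real.log (N x) = (∫ ξ, Real.log |⟪x, (ξ : EuclideanSpace ℝ (Fin n))⟫_ℝ| ∂μ) + C

open Filter Topology FourierTransform ComplexConjugate

/-! By Bochner's theorem `f(‖·‖_K)` is the characteristic function of a finite measure `ν`. Removing
the atom at the origin only subtracts a constant, and the remaining measure is nonzero because `f`
is not constant. Write `N` for the gauge. The characteristic function depends on `ξ` through `N ξ`
alone and `N` is absolutely homogeneous, so the law of `⟪x, ξ⟫ / N ξ` under `ν` is the same for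
every `ξ ≠ 0` (`hasScaledMarginals_of_charFun`). Taking logarithms and integrating gives, formally,
`∫ ln |⟪x, ξ⟫| dν = ν(ℝⁿ) ln N(ξ) + const`. Projecting `ν` radially to the sphere and dividing by
its mass turns this into the claim.

The difficulty is convergence, since `ln ‖x‖` need not be `ν`-integrable. Only `ln |⟪x, ξ⟫| - ln
‖x‖`, which lives on the sphere, is integrated. It is integrable for some `η` by averaging over a
Gaussian `η` (`exists_integrable_log_inner_sub_log_norm`). Equality of the scaled laws, applied to
truncated logarithms, carries integrability to every `ξ` and evaluates the difference of the two
integrals. Absolute values are often omitted because `Real.log` is even. -/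

theorem Complex.nonneg_of_ofReal_mul_nonneg {r : ℝ} (hr : 0 < r) {z : ℂ}
    (h : 0 ≤ (r : ℂ) * z) : 0 ≤ z := by
  have := mul_nonneg (Complex.zero_le_real.2 (inv_nonneg.2 hr.le)) h
  rwa [← mul_assoc, ← Complex.ofReal_mul, inv_mul_cancel₀ hr.ne', Complex.ofReal_one,
    one_mul] at this

/-! ### Positive definite functions and Gaussian damping. -/

section Bochner

variable {n : ℕ} {g : EuclideanSpace ℝ (Fin n) → ℂ}

theorem IsPosDefFun.zero_nonneg (hg : IsPosDefFun g) : 0 ≤ g 0 := by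
  simpa using hg 1 (fun _ => 0) (fun _ => 1)

theorem IsPosDefFun.two_point (hg : IsPosDefFun g) (x : EuclideanSpace ℝ (Fin n)) (c : ℂ) :
    0 ≤ (1 + c * conj c) * g 0 + conj c * g x + c * g (-x) := by
  have h := hg 2 ![x, 0] ![1, c]
  simp only [Fin.sum_univ_two, Matrix.cons_val_zero, Matrix.cons_val_one, sub_self, sub_zero,
    zero_sub, map_one, one_mul, mul_one] at h
  convert h using 1
  ring

theorem IsPosDefFun.map_neg (hg : IsPosDefFun g) (x : EuclideanSpace ℝ (Fin n)) :
    g (-x) = conj (g x) := by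
  have h0 := (Complex.nonneg_iff.1 hg.zero_nonneg).2
  have h1 := (Complex.nonneg_iff.1 (hg.two_point x 1)).2
  have h2 := (Complex.nonneg_iff.1 (hg.two_point x Complex.I)).2
  simp [← h0] at h1 h2
  apply Complex.ext
  · simp; linarith
  · simp; linarith

theorem IsPosDefFun.norm_le (hg : IsPosDefFun g) (x : EuclideanSpace ℝ (Fin n)) :
    ‖g x‖ ≤ (g 0).re := by
  rcases eq_or_ne (g x) 0 with hx | hx
  · simpa [hx] using (Complex.nonneg_iff.1 hg.zero_nonneg).1
  have hn : (‖g x‖ : ℂ) ≠ 0 := by simpa using hx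
  -- This unimodular coefficient makes both cross terms equal to `-‖g x‖`.
  have h := (Complex.nonneg_iff.1 (hg.two_point x (-(g x / ‖g x‖)))).1
  have e : g x * conj (g x) = (‖g x‖ : ℂ) * ‖g x‖ := by
    rw [Complex.mul_conj, Complex.normSq_eq_norm_sq]; push_cast; ring
  have : (1 + -(g x / ‖g x‖) * conj (-(g x / ‖g x‖))) * g 0 + conj (-(g x / ‖g x‖)) * g x +
      -(g x / ‖g x‖) * g (-x) = 2 * g 0 - 2 * ‖g x‖ := by
    rw [hg.map_neg]
    simp only [_root_.map_neg, map_div₀, Complex.conj_ofReal]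
    field_simp
    linear_combination (g 0 - 2 * ‖g x‖) * e
  rw [this] at h
  simp at h
  linarith

theorem IsPosDefFun.mul_exp_inner (hg : IsPosDefFun g) (ξ : EuclideanSpace ℝ (Fin n)) :
    IsPosDefFun (fun x => g x * Complex.exp ((⟪x, ξ⟫_ℝ : ℝ) * Complex.I)) := by
  intro m x c
  have h := hg m x (fun i => c i * Complex.exp ((⟪x i, ξ⟫_ℝ : ℝ) * Complex.I))
  refine h.trans_eq (Finset.sum_congr rfl fun i _ => Finset.sum_congr rfl fun j _ => ?_)
  beta_reduce
  rw [inner_sub_left, map_mul, ← Complex.exp_conj]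
  simp only [map_mul, Complex.conj_ofReal, Complex.conj_I, Complex.ofReal_sub]
  rw [sub_mul, sub_eq_add_neg (_ * _), Complex.exp_add, mul_neg]
  ring

/-- The double integral is approximated by the expectation of the quadratic form at `m`
independent points. -/
theorem IsPosDefFun.integral_prod_nonneg (hg : IsPosDefFun g) (hc : Continuous g)
    (P : Measure (EuclideanSpace ℝ (Fin n))) [IsProbabilityMeasure P] :
    0 ≤ ∫ p, g (p.1 - p.2) ∂(P.prod P) := by
  set J := ∫ p, g (p.1 - p.2) ∂(P.prod P)
  have key (m : ℕ) : 0 ≤ (m : ℂ) * g 0 + (m : ℂ) * (m - 1) * J := by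
    set Q := Measure.pi (fun _ : Fin m => P)
    have hint (i j : Fin m) : Integrable (fun x : Fin m → _ => g (x i - x j)) Q :=
      Integrable.of_bound (Continuous.aestronglyMeasurable (by fun_prop)) (g 0).re
        (ae_of_all _ fun x => hg.norm_le _)
    have hoff (i j : Fin m) (hij : i ≠ j) : ∫ x, g (x i - x j) ∂Q = J := by
      have hind : ProbabilityTheory.IndepFun (fun x : Fin m → EuclideanSpace ℝ (Fin n) => x i)
          (fun x => x j) Q :=
        (ProbabilityTheory.iIndepFun_pi (μ := fun _ : Fin m => P) (X := fun _ x => x)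
          (fun _ => aemeasurable_id)).indepFun hij
      rw [ProbabilityTheory.indepFun_iff_map_prod_eq_prod_map_map
        (measurable_pi_apply i).aemeasurable (measurable_pi_apply j).aemeasurable] at hind
      have hm (k : Fin m) : Q.map (fun x : Fin m → EuclideanSpace ℝ (Fin n) => x k) = P :=
        (measurePreserving_eval (fun _ : Fin m => P) k).map_eq
      rw [hm, hm] at hind
      simp only [J]
      rw [← hind, integral_map (by fun_prop) (Continuous.aestronglyMeasurable (by fun_prop))]
    have hsum : ∫ x, ∑ i, ∑ j, g (x i - x j) ∂Q = (m : ℂ) * g 0 + (m : ℂ) * (m - 1) * J := by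
      rw [integral_finsetSum _ fun i _ => integrable_finsetSum _ fun j _ => hint i j]
      have (i : Fin m) : ∫ x, ∑ j, g (x i - x j) ∂Q = g 0 + (m - 1) * J := by
        rw [integral_finsetSum _ fun j _ => hint i j, ← Finset.add_sum_erase _ _ (Finset.mem_univ i),
          Finset.sum_congr rfl fun j hj => hoff i j (Finset.ne_of_mem_erase hj).symm]
        have : 1 ≤ m := i.pos
        simp [Finset.card_erase_of_mem, Nat.cast_sub this]
      simp only [this, Finset.sum_const, Finset.card_univ, Fintype.card_fin, nsmul_eq_mul]
      ring
    rw [← hsum]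
    refine integral_nonneg fun x => ?_
    simpa using hg m x (fun _ => 1)
  have hlim : Tendsto (fun m : ℕ => ((m : ℂ) + 1)⁻¹ * g 0 + (1 - ((m : ℂ) + 1)⁻¹) * J) atTop
      (𝓝 (0 * g 0 + (1 - 0) * J)) := by
    have : Tendsto (fun m : ℕ => ((m : ℂ) + 1)⁻¹) atTop (𝓝 0) := by
      simpa [one_div] using tendsto_one_div_add_atTop_nhds_zero_nat (𝕜 := ℂ)
    exact (this.mul_const _).add ((tendsto_const_nhds.sub this).mul_const _)
  simp only [zero_mul, sub_zero, one_mul, zero_add] at hlim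
  refine ge_of_tendsto' hlim fun m => ?_
  have hm : ((m : ℂ) + 1) ≠ 0 := Nat.cast_add_one_ne_zero m
  have h2 : (0 : ℂ) ≤ (((m : ℝ) + 1)⁻¹ ^ 2 : ℝ) := Complex.zero_le_real.2 (by positivity)
  -- The diagonal has `m + 1` terms and the off-diagonal `(m + 1) * m`; after division by `(m + 1) ^
  -- 2` only `J` survives in the limit.
  have := mul_nonneg h2 (key (m + 1))
  convert this using 1
  push_cast
  field_simp

theorem integrable_exp_neg_mul_sq_norm {V : Type*} [NormedAddCommGroup V] [InnerProductSpace ℝ V]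
    [FiniteDimensional ℝ V] [MeasurableSpace V] [BorelSpace V] {b : ℝ} (hb : 0 < b) :
    Integrable (fun v : V => Real.exp (-b * ‖v‖ ^ 2)) := by
  have h := (GaussianFourier.integrable_cexp_neg_mul_sq_norm_add (V := V) (b := b)
    (by simpa using hb) 0 0).norm
  simpa [Complex.norm_exp, ← Complex.ofReal_pow] using h

theorem IsPosDefFun.integrable_mul_gaussian (hg : IsPosDefFun g) (hc : Continuous g) {b : ℝ}
    (hb : 0 < b) : Integrable (fun u => g u * (Real.exp (-b * ‖u‖ ^ 2) : ℝ)) :=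
  (integrable_exp_neg_mul_sq_norm hb).ofReal.bdd_mul (c := (g 0).re)
    hc.aestronglyMeasurable (ae_of_all _ hg.norm_le)

/-- The autocorrelation of a Gaussian is again a Gaussian. -/
theorem IsPosDefFun.integral_integral_gaussian_mul (hg : IsPosDefFun g) (hc : Continuous g)
    {b : ℝ} (hb : 0 < b) :
    ∫ x, ∫ y, (Real.exp (-(2 * b) * ‖x‖ ^ 2) : ℂ) * ((Real.exp (-(2 * b) * ‖y‖ ^ 2) : ℂ) *
      g (x - y)) = (∫ y : EuclideanSpace ℝ (Fin n), Real.exp (-(4 * b) * ‖y‖ ^ 2) : ℝ) *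
        ∫ u, g u * (Real.exp (-b * ‖u‖ ^ 2) : ℝ) := by
  set w : EuclideanSpace ℝ (Fin n) → ℝ := fun v => Real.exp (-(2 * b) * ‖v‖ ^ 2)
  have hwi : Integrable w := integrable_exp_neg_mul_sq_norm (by positivity)
  have hwc : Continuous w := by fun_prop
  set F : EuclideanSpace ℝ (Fin n) × EuclideanSpace ℝ (Fin n) → ℂ :=
    fun p => (w p.1 : ℂ) * ((w p.2 : ℂ) * g (p.1 - p.2))
  have hFc : Continuous F := by fun_prop
  have hFi : Integrable F (volume.prod volume) := by
    have := (hwi.ofReal (𝕜 := ℂ)).mul_prod (hwi.ofReal (𝕜 := ℂ))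
    refine (this.mul_bdd (c := (g 0).re) (g := fun p => g (p.1 - p.2))
      (Continuous.aestronglyMeasurable (by fun_prop)) (ae_of_all _ fun _ => hg.norm_le _)).congr
      (ae_of_all _ fun p => ?_)
    simp [F, mul_assoc]
  change ∫ x, ∫ y, F (x, y) = _
  rw [← integral_prod F hFi]
  -- The shear `x = y + u` makes the argument of `g` equal to `u`.
  have hT : MeasurePreserving (fun z : EuclideanSpace ℝ (Fin n) × EuclideanSpace ℝ (Fin n) =>
      (z.2 + z.1, z.2)) (volume.prod volume) (volume.prod volume) :=
    Measure.measurePreserving_swap.comp (measurePreserving_prod_add_swap volume volume)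
  have hFT (p : EuclideanSpace ℝ (Fin n) × EuclideanSpace ℝ (Fin n)) :
      F (p.2 + p.1, p.2) =
        g p.1 * (Real.exp (-b * ‖p.1‖ ^ 2) : ℝ) *
          (Real.exp (-(4 * b) * ‖p.2 + (1 / 2 : ℝ) • p.1‖ ^ 2) : ℝ) := by
    -- Completing the square in `y` separates the variables up to a translation of `y`, which the
    -- integral ignores.
    have e : Real.exp (-(2 * b) * ‖p.2 + p.1‖ ^ 2) * Real.exp (-(2 * b) * ‖p.2‖ ^ 2) =
        Real.exp (-b * ‖p.1‖ ^ 2) * Real.exp (-(4 * b) * ‖p.2 + (1 / 2 : ℝ) • p.1‖ ^ 2) := by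
      rw [← Real.exp_add, ← Real.exp_add, norm_add_sq_real, norm_add_sq_real, norm_smul,
        real_inner_smul_right]
      congr 1
      norm_num
      ring
    simp only [F, w, add_sub_cancel_left]
    rw [← mul_assoc, ← Complex.ofReal_mul, e]
    push_cast
    ring
  rw [← hT.map_eq, integral_map hT.measurable.aemeasurable hFc.aestronglyMeasurable]
  have hi2 := hT.integrable_comp_of_integrable hFi
  simp only [Function.comp_def, hFT] at hi2 ⊢
  rw [integral_prod _ hi2]
  simp only [integral_const_mul, integral_complex_ofReal]
  have hin (x : EuclideanSpace ℝ (Fin n)) :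
      ∫ y : EuclideanSpace ℝ (Fin n), Real.exp (-(4 * b) * ‖y + (1 / 2 : ℝ) • x‖ ^ 2) =
        ∫ y : EuclideanSpace ℝ (Fin n), Real.exp (-(4 * b) * ‖y‖ ^ 2) :=
    integral_add_right_eq_self (fun y : EuclideanSpace ℝ (Fin n) =>
      Real.exp (-(4 * b) * ‖y‖ ^ 2)) _
  simp only [hin, integral_mul_const]
  rw [mul_comm]

/-- The double integral against a normalised Gaussian is nonnegative, and the autocorrelation
identity reduces it to a positive multiple of this single integral. -/
theorem IsPosDefFun.integral_mul_gaussian_nonneg (hg : IsPosDefFun g) (hc : Continuous g) {b : ℝ}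
    (hb : 0 < b) : 0 ≤ ∫ u, g u * (Real.exp (-b * ‖u‖ ^ 2) : ℝ) := by
  set w : EuclideanSpace ℝ (Fin n) → ℝ := fun v => Real.exp (-(2 * b) * ‖v‖ ^ 2)
  have hwi : Integrable w := integrable_exp_neg_mul_sq_norm (by positivity)
  have hwc : Continuous w := by fun_prop
  set P := volume.withDensity (fun v => ENNReal.ofReal (w v))
  have hP0 : P ≠ 0 := by
    intro h
    have := (withDensity_eq_zero_iff (by fun_prop)).1 h
    have h2 : ∀ᵐ v : EuclideanSpace ℝ (Fin n), False := by
      filter_upwards [this] with v hv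
      simp [w, not_le.2 (Real.exp_pos _)] at hv
    exact NeZero.ne (volume : Measure (EuclideanSpace ℝ (Fin n))) (by simpa using h2)
  have : NeZero P := ⟨hP0⟩
  have : IsFiniteMeasure P := isFiniteMeasure_withDensity_ofReal hwi.2
  have h := hg.integral_prod_nonneg hc ((P Set.univ)⁻¹ • P)
  have hgi (Q : Measure (EuclideanSpace ℝ (Fin n) × EuclideanSpace ℝ (Fin n)))
      [IsFiniteMeasure Q] : Integrable (fun p => g (p.1 - p.2)) Q :=
    Integrable.of_bound (Continuous.aestronglyMeasurable (by fun_prop)) (g 0).re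
        (ae_of_all _ fun x => hg.norm_le _)
  rw [integral_prod _ (hgi _)] at h
  have hc0 : 0 < ((P Set.univ)⁻¹).toReal :=
    ENNReal.toReal_pos (by simp) (by simp [hP0])
  have hP (F : EuclideanSpace ℝ (Fin n) → ℂ) : ∫ x, F x ∂P = ∫ x, (w x : ℂ) * F x := by
    simp only [P]
    rw [integral_withDensity_eq_integral_toReal_smul (by fun_prop)
      (ae_of_all _ fun _ => ENNReal.ofReal_lt_top)]
    simp only [ENNReal.toReal_ofReal (Real.exp_pos _).le, w, Complex.real_smul]
  simp only [integral_smul_measure, hP, Complex.real_smul] at h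
  have h : 0 ≤ ∫ x, (w x : ℂ) * ∫ y, (w y : ℂ) * g (x - y) := by
    refine Complex.nonneg_of_ofReal_mul_nonneg hc0 (Complex.nonneg_of_ofReal_mul_nonneg hc0
      (h.trans_eq ?_))
    simp only [mul_left_comm _ (((P Set.univ)⁻¹).toReal : ℂ), integral_const_mul]
  have h2 := hg.integral_integral_gaussian_mul hc hb
  simp only [integral_const_mul] at h2
  rw [h2] at h
  refine Complex.nonneg_of_ofReal_mul_nonneg ?_ h
  rw [GaussianFourier.integral_rexp_neg_mul_sq_norm (by positivity)]
  positivity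

/-- Multiplication by a character preserves positive definiteness, so the value at any frequency
reduces to the plain integral. -/
theorem IsPosDefFun.fourier_mul_gaussian_nonneg (hg : IsPosDefFun g) (hc : Continuous g) {b : ℝ}
    (hb : 0 < b) (ξ : EuclideanSpace ℝ (Fin n)) :
    0 ≤ 𝓕 (fun u => g u * (Real.exp (-b * ‖u‖ ^ 2) : ℝ)) ξ := by
  have h := (hg.mul_exp_inner ((-(2 * Real.pi)) • ξ)).integral_mul_gaussian_nonneg
    (by fun_prop) hb
  rw [Real.fourier_eq']
  refine h.trans_eq (integral_congr_ae (ae_of_all _ fun u => ?_))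
  beta_reduce
  rw [real_inner_smul_right, smul_eq_mul]
  push_cast
  ring_nf

end Bochner

/-! ### Functions with nonnegative Fourier transform. -/

section FourierNonneg

variable {V : Type*} [NormedAddCommGroup V] [InnerProductSpace ℝ V] [FiniteDimensional ℝ V]
  [MeasurableSpace V] [BorelSpace V] {h : V → ℂ}

/-- Gaussian means of `𝓕 h` converge to `h 0`. As `𝓕 h` is nonnegative, Fatou's lemma bounds its
integral by `h 0`. -/
theorem integrable_fourier_of_nonneg (hi : Integrable h) (hc : Continuous h)
    (hpos : ∀ ξ, 0 ≤ 𝓕 h ξ) : Integrable (𝓕 h) := by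
  have hFc : Continuous (𝓕 h) :=
    VectorFourier.fourierIntegral_continuous Real.continuous_fourierChar continuous_inner hi
  have hpos' (ξ : V) : 0 ≤ (𝓕 h ξ).re := (Complex.nonneg_iff.1 (hpos ξ)).1
  have hre (ξ : V) : 𝓕 h ξ = ((𝓕 h ξ).re : ℂ) :=
    Complex.ext rfl (by simpa using (Complex.nonneg_iff.1 (hpos ξ)).2.symm)
  have hlim : Tendsto (fun c : ℝ => ∫ w : V, Complex.exp (-c⁻¹ * ‖w‖ ^ 2) • 𝓕 h w) atTop
      (𝓝 (h 0)) := by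
    refine (Real.tendsto_integral_gaussian_smul' hi hc.continuousAt).congr' ?_
    filter_upwards [Ioi_mem_atTop 0] with c (hc : 0 < c)
    have J : Integrable (fun w : V => Complex.exp (- c⁻¹ * ‖w‖ ^ 2)) := by
      simpa using GaussianFourier.integrable_cexp_neg_mul_sq_norm_add (V := V)
        (b := (c⁻¹ : ℂ)) (by simpa) 0 0
    -- The transform moves from `h` to the Gaussian, whose transform is an approximate identity at
    -- the origin.
    have := VectorFourier.integral_fourierIntegral_smul_eq_flip (L := innerₗ V)
      Real.continuous_fourierChar continuous_inner J hi
    have e : VectorFourier.fourierIntegral Real.fourierChar volume (innerₗ V).flip h = 𝓕 h := by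
      simp only [flip_innerₗ]; rfl
    rw [e] at this
    rw [← this]
    refine integral_congr_ae (ae_of_all _ fun w => ?_)
    change _ = 𝓕 (fun w : V => Complex.exp (- c⁻¹ * ‖w‖ ^ 2)) w * h w
    rw [fourier_gaussian_innerProductSpace (by simpa)]
    beta_reduce
    rw [smul_eq_mul]
    congr 2
    · simp
    · simp
      ring_nf
  have hGi (c : ℝ) (hc : 0 < c) : Integrable
      (fun w : V => Real.exp (-c⁻¹ * ‖w‖ ^ 2) * (𝓕 h w).re) := by
    refine (integrable_exp_neg_mul_sq_norm (inv_pos.2 hc)).mul_bdd (c := ∫ v, ‖h v‖)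
      (Complex.continuous_re.comp hFc).aestronglyMeasurable (ae_of_all _ fun w => ?_)
    refine (Complex.abs_re_le_norm _).trans ?_
    exact VectorFourier.norm_fourierIntegral_le_integral_norm _ _ _ _ _
  have hlim2 : Tendsto (fun k : ℕ => ENNReal.ofReal
      (∫ w : V, Real.exp (-((k : ℝ) + 1)⁻¹ * ‖w‖ ^ 2) * (𝓕 h w).re)) atTop
      (𝓝 (ENNReal.ofReal (h 0).re)) := by
    refine (ENNReal.continuous_ofReal.tendsto _).comp ?_
    have h1 : Tendsto (fun k : ℕ => (k : ℝ) + 1) atTop atTop :=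
      tendsto_atTop_add_const_right _ _ tendsto_natCast_atTop_atTop
    refine ((Complex.continuous_re.tendsto _).comp (hlim.comp h1)).congr fun k => ?_
    simp only [Function.comp]
    rw [← Complex.ofReal_re (∫ w : V, _), ← integral_complex_ofReal]
    congr 2 with w
    rw [smul_eq_mul]
    conv_lhs => rw [hre w]
    push_cast
    rfl
  have hF : ∫⁻ w, ENNReal.ofReal (𝓕 h w).re ≤ ENNReal.ofReal (h 0).re := by
    have hpt (w : V) : Tendsto (fun k : ℕ => ENNReal.ofReal
        (Real.exp (-((k : ℝ) + 1)⁻¹ * ‖w‖ ^ 2) * (𝓕 h w).re)) atTop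
        (𝓝 (ENNReal.ofReal (𝓕 h w).re)) := by
      refine (ENNReal.continuous_ofReal.tendsto _).comp ?_
      have h0 : Tendsto (fun k : ℕ => ((k : ℝ) + 1)⁻¹) atTop (𝓝 0) := by
        simpa [one_div] using tendsto_one_div_add_atTop_nhds_zero_nat (𝕜 := ℝ)
      have := ((Real.continuous_exp.tendsto _).comp (h0.neg.mul_const (‖w‖ ^ 2))).mul_const
        (𝓕 h w).re
      simpa using this
    calc ∫⁻ w, ENNReal.ofReal (𝓕 h w).re
        = ∫⁻ w, liminf (fun k : ℕ => ENNReal.ofReal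
            (Real.exp (-((k : ℝ) + 1)⁻¹ * ‖w‖ ^ 2) * (𝓕 h w).re)) atTop :=
          lintegral_congr fun w => (hpt w).liminf_eq.symm
      _ ≤ liminf (fun k : ℕ => ∫⁻ w, ENNReal.ofReal
            (Real.exp (-((k : ℝ) + 1)⁻¹ * ‖w‖ ^ 2) * (𝓕 h w).re)) atTop :=
          lintegral_liminf_le fun k => by
            have := Complex.continuous_re.comp hFc
            simp only [Function.comp_def] at this
            fun_prop
      _ = ENNReal.ofReal (h 0).re := by
          rw [← hlim2.liminf_eq]
          congr with k
          rw [ofReal_integral_eq_lintegral_ofReal (hGi _ (by positivity))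
            (ae_of_all _ fun w => mul_nonneg (Real.exp_pos _).le (hpos' w))]
  refine ⟨hFc.aestronglyMeasurable, ?_⟩
  rw [hasFiniteIntegral_iff_norm]
  refine lt_of_le_of_lt (le_of_eq (lintegral_congr fun w => ?_)) (hF.trans_lt ENNReal.ofReal_lt_top)
  rw [hre w, Complex.norm_real, Real.norm_of_nonneg (hpos' w), Complex.ofReal_re]

theorem exists_charFun_eq_of_fourier_nonneg (hi : Integrable h) (hc : Continuous h)
    (hpos : ∀ ξ, 0 ≤ 𝓕 h ξ) : ∃ ν : Measure V, IsFiniteMeasure ν ∧ charFun ν = h := by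
  have hFi := integrable_fourier_of_nonneg hi hc hpos
  have hpos' (ξ : V) : 0 ≤ (𝓕 h ξ).re := (Complex.nonneg_iff.1 (hpos ξ)).1
  have hre (ξ : V) : 𝓕 h ξ = ((𝓕 h ξ).re : ℂ) :=
    Complex.ext rfl (by simpa using (Complex.nonneg_iff.1 (hpos ξ)).2.symm)
  set ρ : Measure V := volume.withDensity (fun w => ENNReal.ofReal (𝓕 h w).re) with hρ
  have : IsFiniteMeasure ρ := isFiniteMeasure_withDensity_ofReal hFi.re.2
  -- The dilation reconciles the `2π` in the exponent of `𝓕` with its absence from `charFun`.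
  refine ⟨ρ.map (fun w => (2 * Real.pi) • w), inferInstance, ?_⟩
  rw [← hc.fourierInv_fourier_eq hi hFi]
  ext v
  rw [charFun_apply, integral_map (by fun_prop) (Continuous.aestronglyMeasurable (by fun_prop)),
    Real.fourierInv_eq', hρ, integral_withDensity_eq_integral_toReal_smul₀
      (f := fun w => ENNReal.ofReal (𝓕 h w).re) hFi.re.1.aemeasurable.ennreal_ofReal (ae_of_all _ fun _ => ENNReal.ofReal_lt_top)]
  refine integral_congr_ae (ae_of_all _ fun w => ?_)
  beta_reduce
  conv_rhs => rw [hre w]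
  rw [ENNReal.toReal_ofReal (hpos' w), Complex.real_smul, smul_eq_mul, mul_comm,
    real_inner_smul_left]

end FourierNonneg

/-! ### Bochner's theorem. -/

section Bochner

variable {n : ℕ} {g : EuclideanSpace ℝ (Fin n) → ℂ}

/-- Each damped function is a characteristic function. As the damping vanishes, continuity of the
limit at the origin makes the measures tight, and Prokhorov's theorem yields a limit measure. -/
theorem IsPosDefFun.exists_probabilityMeasure (hg : IsPosDefFun g) (hc : Continuous g)
    (h0 : g 0 = 1) : ∃ ν : ProbabilityMeasure (EuclideanSpace ℝ (Fin n)),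
      charFun (ν : Measure (EuclideanSpace ℝ (Fin n))) = g := by
  have hk (k : ℕ) : ∃ ν : ProbabilityMeasure (EuclideanSpace ℝ (Fin n)),
      charFun (ν : Measure (EuclideanSpace ℝ (Fin n))) =
        fun u => g u * (Real.exp (-((k : ℝ) + 1)⁻¹ * ‖u‖ ^ 2) : ℝ) := by
    have hb : 0 < ((k : ℝ) + 1)⁻¹ := by positivity
    obtain ⟨ν, hν, h⟩ := exists_charFun_eq_of_fourier_nonneg (hg.integrable_mul_gaussian hc hb)
      (by fun_prop) (hg.fourier_mul_gaussian_nonneg hc hb)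
    refine ⟨⟨ν, ⟨?_⟩⟩, h⟩
    have h1 := congr_fun h 0
    rw [charFun_zero] at h1
    simp [h0] at h1
    simpa [measureReal_def, ENNReal.toReal_eq_one_iff] using h1
  choose ν hν using hk
  have hlim (t : EuclideanSpace ℝ (Fin n)) : Tendsto (fun k =>
      charFun (ν k : Measure (EuclideanSpace ℝ (Fin n))) t) atTop (𝓝 (g t)) := by
    simp only [hν]
    have h0 : Tendsto (fun k : ℕ => ((k : ℝ) + 1)⁻¹) atTop (𝓝 0) := by
      simpa [one_div] using tendsto_one_div_add_atTop_nhds_zero_nat (𝕜 := ℝ)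
    have := (((Complex.continuous_ofReal.comp Real.continuous_exp).tendsto _).comp
      (h0.neg.mul_const (‖t‖ ^ 2))).const_mul (g t)
    simpa [-Complex.ofReal_exp] using this
  have htight := isTightMeasureSet_of_tendsto_charFun hc.continuousAt hlim
  have hcomp : IsCompact (closure (Set.range ν)) := by
    refine isCompact_closure_of_isTightMeasureSet ?_
    refine htight.subset ?_
    rintro _ ⟨_, ⟨k, rfl⟩, rfl⟩
    exact ⟨k, rfl⟩
  obtain ⟨ν₀, -, φ, hφ, hν₀⟩ := hcomp.tendsto_subseq (x := ν)
    fun k => subset_closure (Set.mem_range_self k)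
  refine ⟨ν₀, funext fun t => ?_⟩
  exact tendsto_nhds_unique (ProbabilityMeasure.tendsto_iff_tendsto_charFun.1 hν₀ t)
    ((hlim t).comp hφ.tendsto_atTop)

/-- **Bochner's theorem** on `ℝⁿ`. -/
theorem IsPosDefFun.exists_charFun_eq (hg : IsPosDefFun g) (hc : Continuous g) :
    ∃ ν : Measure (EuclideanSpace ℝ (Fin n)), IsFiniteMeasure ν ∧ charFun ν = g := by
  obtain ⟨hre, him⟩ := Complex.nonneg_iff.1 hg.zero_nonneg
  have hg0 : g 0 = ((g 0).re : ℂ) := Complex.ext rfl (by simpa using him.symm)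
  rcases hre.eq_or_lt with h | h
  · refine ⟨0, inferInstance, funext fun t => ?_⟩
    have := hg.norm_le t
    rw [← h, norm_le_zero_iff] at this
    simp [this]
  have hpd : IsPosDefFun (fun x => ((g 0).re⁻¹ : ℝ) * g x) := by
    intro m x c
    refine (mul_nonneg (Complex.zero_le_real.2 (inv_nonneg.2 hre)) (hg m x c)).trans_eq ?_
    simp only [Finset.mul_sum]
    exact Finset.sum_congr rfl fun i _ => Finset.sum_congr rfl fun j _ => by ring
  have hne : ((g 0).re : ℂ) ≠ 0 := by exact_mod_cast h.ne'
  obtain ⟨ν, hν⟩ := hpd.exists_probabilityMeasure (by fun_prop)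
    (by rw [hg0]; push_cast; exact inv_mul_cancel₀ hne)
  refine ⟨ENNReal.ofReal (g 0).re • (ν : Measure _),
    Measure.smul_finite _ ENNReal.ofReal_ne_top, funext fun t => ?_⟩
  have := congr_fun hν t
  rw [charFun_apply] at this
  rw [charFun_apply, integral_smul_measure, this, ENNReal.toReal_ofReal hre, Complex.real_smul,
    ← mul_assoc, ← Complex.ofReal_mul, mul_inv_cancel₀ h.ne', Complex.ofReal_one, one_mul]

end Bochner

/-! ### Truncation and differences of possibly non-integrable functions. -/

section Clamp

/-- Truncation of a real number to the interval `[-T, T]`. -/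
noncomputable def clamp (T : ℕ) (u : ℝ) : ℝ := max (-(T : ℝ)) (min u T)

theorem continuous_clamp (T : ℕ) : Continuous (clamp T) := by
  unfold clamp; fun_prop

theorem monotone_clamp (T : ℕ) : Monotone (clamp T) := fun _ _ h =>
  max_le_max le_rfl (min_le_min h le_rfl)

theorem abs_clamp_le (T : ℕ) (u : ℝ) : |clamp T u| ≤ T := by
  have : (0 : ℝ) ≤ T := T.cast_nonneg
  exact abs_le.2 ⟨le_max_left _ _, max_le (by linarith) (min_le_right _ _)⟩

theorem abs_clamp_sub_clamp_le (T : ℕ) (u v : ℝ) : |clamp T u - clamp T v| ≤ |u - v| := by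
  have h1 := abs_max_sub_max_le_abs (min u (T : ℝ)) (min v T) (-(T : ℝ))
  rw [max_comm, max_comm (min v _)] at h1
  exact h1.trans (abs_min_sub_min_le_max u T v T |>.trans (by simp))

theorem tendsto_clamp (u : ℝ) : Tendsto (fun T => clamp T u) atTop (𝓝 u) := by
  obtain ⟨T₀, hT₀⟩ := exists_nat_ge |u|
  refine tendsto_const_nhds.congr' ?_
  filter_upwards [eventually_ge_atTop T₀] with T hT
  have : |u| ≤ T := hT₀.trans (by exact_mod_cast hT)
  obtain ⟨h1, h2⟩ := abs_le.1 this
  rw [clamp, min_eq_left h2, max_eq_right h1]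

variable {α : Type*} [MeasurableSpace α] {μ : Measure α} {u v : α → ℝ}

theorem Measurable.integrable_clamp [IsFiniteMeasure μ] (hu : Measurable u) (T : ℕ) :
    Integrable (fun x => clamp T (u x)) μ :=
  Integrable.of_bound ((continuous_clamp T).measurable.comp hu).aestronglyMeasurable T
    (ae_of_all _ fun _ => abs_clamp_le T _)

/-- Since truncation is 1-Lipschitz, `|u - v|` dominates, although neither `u` nor `v` need be
integrable. -/
theorem tendsto_integral_clamp_sub_clamp [IsFiniteMeasure μ] (hu : Measurable u)
    (hv : Measurable v) (h : Integrable (fun x => u x - v x) μ) :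
    Tendsto (fun T => ∫ x, clamp T (u x) ∂μ - ∫ x, clamp T (v x) ∂μ) atTop
      (𝓝 (∫ x, (u x - v x) ∂μ)) := by
  simp only [← integral_sub (hu.integrable_clamp _) (hv.integrable_clamp _)]
  exact tendsto_integral_of_dominated_convergence (fun x => |u x - v x|)
    (fun T => ((hu.integrable_clamp T).sub (hv.integrable_clamp T)).1) h.abs
    (fun T => ae_of_all _ fun x => abs_clamp_sub_clamp_le T _ _)
    (ae_of_all _ fun x => (tendsto_clamp _).sub (tendsto_clamp _))

/-- Monotonicity keeps the truncated differences nonnegative almost everywhere, so Fatou's lemma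
applies. -/
theorem integrable_sub_of_integral_clamp_le [IsFiniteMeasure μ] (hu : Measurable u)
    (hv : Measurable v) (huv : ∀ᵐ x ∂μ, v x ≤ u x) (C : ℝ)
    (hC : ∀ T, ∫ x, clamp T (u x) ∂μ - ∫ x, clamp T (v x) ∂μ ≤ C) :
    Integrable (fun x => u x - v x) μ := by
  have hle : ∫⁻ x, ENNReal.ofReal (u x - v x) ∂μ ≤ ENNReal.ofReal C := by
    calc ∫⁻ x, ENNReal.ofReal (u x - v x) ∂μ
        = ∫⁻ x, liminf (fun T => ENNReal.ofReal (clamp T (u x) - clamp T (v x))) atTop ∂μ :=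
          lintegral_congr fun x => (((ENNReal.continuous_ofReal.tendsto _).comp
            ((tendsto_clamp (u x)).sub (tendsto_clamp (v x)))).liminf_eq).symm
      _ ≤ liminf (fun T => ∫⁻ x, ENNReal.ofReal (clamp T (u x) - clamp T (v x)) ∂μ) atTop :=
          lintegral_liminf_le fun T => (((continuous_clamp T).measurable.comp hu).sub
            ((continuous_clamp T).measurable.comp hv)).ennreal_ofReal
      _ ≤ ENNReal.ofReal C := by
          refine liminf_le_of_le (by isBoundedDefault) fun b hb => ?_
          obtain ⟨T, hT⟩ := hb.exists
          refine hT.trans ?_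
          rw [← ofReal_integral_eq_lintegral_ofReal (f := fun x => clamp T (u x) - clamp T (v x))
            ((hu.integrable_clamp T).sub (hv.integrable_clamp T)),
            integral_sub (hu.integrable_clamp _) (hv.integrable_clamp _)]
          · exact ENNReal.ofReal_le_ofReal (hC T)
          · filter_upwards [huv] with x hx
            exact sub_nonneg.2 (monotone_clamp T hx)
  refine ⟨(hu.sub hv).aestronglyMeasurable, ?_⟩
  rw [hasFiniteIntegral_iff_norm]
  refine (lintegral_congr_ae ?_).trans_lt (hle.trans_lt ENNReal.ofReal_lt_top)
  filter_upwards [huv] with x hx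
  rw [Real.norm_of_nonneg (sub_nonneg.2 hx)]

end Clamp

/-! ### Logarithms of Gaussian marginals. -/

section Gaussian

open ProbabilityTheory

/-- On `[-1, 1]` the density is bounded and `log` is Lebesgue integrable; elsewhere `|log x| ≤ |x|`.
-/
theorem integrable_log_gaussianReal : Integrable Real.log (gaussianReal 0 1) := by
  have hle : gaussianReal 0 1 ≤ ENNReal.ofReal (√(2 * Real.pi))⁻¹ • volume := by
    rw [gaussianReal_of_var_ne_zero _ one_ne_zero, ← withDensity_const]
    refine withDensity_mono (ae_of_all _ fun x => ENNReal.ofReal_le_ofReal ?_)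
    rw [gaussianPDFReal]
    simp only [NNReal.coe_one, mul_one]
    refine mul_le_of_le_one_right (by positivity) (Real.exp_le_one_iff.2 ?_)
    have := sq_nonneg (x - 0)
    linarith
  have h1 : IntegrableOn Real.log (Set.Icc (-1) 1) (gaussianReal 0 1) := by
    have : IntegrableOn Real.log (Set.Icc (-1) 1) volume := by
      rw [← intervalIntegrable_iff_integrableOn_Icc_of_le (by norm_num)]
      exact intervalIntegral.intervalIntegrable_log'
    exact ((this.smul_measure ENNReal.ofReal_ne_top).mono_measure
      ((Measure.restrict_mono subset_rfl hle).trans_eq (Measure.restrict_smul _ _ _)))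
  have h2 : IntegrableOn Real.log (Set.Icc (-1) 1)ᶜ (gaussianReal 0 1) := by
    have hid : Integrable id (gaussianReal 0 1) := IsGaussian.integrable_id
    refine Integrable.mono hid.integrableOn Real.measurable_log.aestronglyMeasurable ?_
    refine (ae_restrict_iff' measurableSet_Icc.compl).2 (ae_of_all _ fun x hx => ?_)
    have hx1 : 1 < |x| := by
      by_contra! h
      exact hx (abs_le.1 h)
    rw [id, Real.norm_eq_abs, Real.norm_eq_abs, ← Real.log_abs, abs_of_pos (Real.log_pos hx1)]
    linarith [Real.log_le_sub_one_of_pos (zero_lt_one.trans hx1)]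
  simpa using h1.union h2

variable {V : Type*} [NormedAddCommGroup V] [InnerProductSpace ℝ V] [FiniteDimensional ℝ V]
  [MeasurableSpace V] [BorelSpace V]

theorem stdGaussian_map_inner {θ : V} (hθ : ‖θ‖ = 1) :
    (stdGaussian V).map (fun ξ => ⟪θ, ξ⟫_ℝ) = gaussianReal 0 1 := by
  refine Measure.ext_of_charFun (funext fun t => ?_)
  have h := charFun_stdGaussian (t • θ)
  rw [charFun_apply] at h
  rw [charFun_gaussianReal, charFun_apply, integral_map (by fun_prop)
    (Continuous.aestronglyMeasurable (by fun_prop))]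
  simp only [real_inner_smul_right, norm_smul, hθ, mul_one, Real.norm_eq_abs] at h
  have e (ξ : V) : ⟪⟪θ, ξ⟫_ℝ, t⟫_ℝ = t * ⟪ξ, θ⟫_ℝ := by
    rw [real_inner_comm θ ξ]; simp
  simp only [e]
  rw [h, ← Complex.ofReal_pow, sq_abs]
  simp [neg_div]

theorem inner_inv_norm_smul {V : Type*} [NormedAddCommGroup V] [InnerProductSpace ℝ V] (x ξ : V) :
    ⟪‖x‖⁻¹ • x, ξ⟫_ℝ = ⟪x, ξ⟫_ℝ / ‖x‖ := by
  rw [real_inner_smul_left, div_eq_inv_mul]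

theorem stdGaussian_ae_inner_ne_zero {x : V} (hx : x ≠ 0) :
    ∀ᵐ ξ ∂(stdGaussian V), ⟪x, ξ⟫_ℝ ≠ 0 := by
  have hθ : ‖(‖x‖⁻¹ • x : V)‖ = 1 := norm_smul_inv_norm (𝕜 := ℝ) hx
  have : NullSingletonClass (gaussianReal 0 1) := nullSingletonClass_gaussianReal one_ne_zero
  have h : ∀ᵐ t ∂(gaussianReal 0 1), t ≠ 0 := by
    simp [ae_iff]
  rw [← stdGaussian_map_inner hθ] at h
  filter_upwards [ae_of_ae_map (by fun_prop) h] with ξ hξ h0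
  exact hξ (by rw [inner_inv_norm_smul, h0, zero_div])

theorem stdGaussian_ae_ne_zero [Nontrivial V] : ∀ᵐ ξ ∂(stdGaussian V), ξ ≠ 0 := by
  obtain ⟨x, hx⟩ := exists_ne (0 : V)
  filter_upwards [stdGaussian_ae_inner_ne_zero hx] with ξ hξ h0
  simp [h0] at hξ

/-- For Gaussian `ξ`, the law of `⟪x / ‖x‖, ξ⟫` is standard normal whatever `x ≠ 0` is. The absolute
integral over `ξ` is thus a constant in `x`, and Fubini's theorem gives integrability in `x` for
almost every `ξ`. -/
theorem exists_integrable_log_inner_sub_log_norm [Nontrivial V] {ν : Measure V}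
    [IsFiniteMeasure ν] (h0 : ∀ᵐ x ∂ν, x ≠ 0) :
    ∃ η : V, η ≠ 0 ∧ Integrable (fun x => Real.log ⟪x, η⟫_ℝ - Real.log ‖x‖) ν := by
  have hm : Measurable (fun p : V × V => Real.log ⟪p.1, p.2⟫_ℝ - Real.log ‖p.1‖) := by fun_prop
  have hae (x : V) (hx : x ≠ 0) : (fun ξ => Real.log ⟪x, ξ⟫_ℝ - Real.log ‖x‖) =ᵐ[stdGaussian V]
      fun ξ => Real.log ⟪‖x‖⁻¹ • x, ξ⟫_ℝ := by
    filter_upwards [stdGaussian_ae_inner_ne_zero hx] with ξ hξ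
    rw [inner_inv_norm_smul, Real.log_div hξ (norm_ne_zero_iff.2 hx)]
  have hθ (x : V) (hx : x ≠ 0) : ‖(‖x‖⁻¹ • x : V)‖ = 1 := norm_smul_inv_norm (𝕜 := ℝ) hx
  have hint : Integrable (fun p : V × V => Real.log ⟪p.1, p.2⟫_ℝ - Real.log ‖p.1‖)
      (ν.prod (stdGaussian V)) := by
    rw [integrable_prod_iff hm.aestronglyMeasurable]
    constructor
    · filter_upwards [h0] with x hx
      rw [integrable_congr (hae x hx)]
      have h := integrable_log_gaussianReal
      rw [← stdGaussian_map_inner (hθ x hx)] at h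
      exact h.comp_measurable (by fun_prop)
    · refine (integrable_const (∫ t, ‖Real.log t‖ ∂(gaussianReal 0 1))).congr ?_
      filter_upwards [h0] with x hx
      rw [← stdGaussian_map_inner (hθ x hx), integral_map (by fun_prop)
        Real.measurable_log.norm.aestronglyMeasurable]
      refine integral_congr_ae ?_
      filter_upwards [hae x hx] with ξ hξ
      rw [hξ]
  obtain ⟨η, h1, h2⟩ := (hint.prod_left_ae.and stdGaussian_ae_ne_zero).exists
  exact ⟨η, h2, h1⟩

end Gaussian

/-! ### Measures whose marginals agree up to scaling. -/

section Scaling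

open ProbabilityTheory

variable {V : Type*} [NormedAddCommGroup V] [InnerProductSpace ℝ V] [FiniteDimensional ℝ V]
  [MeasurableSpace V] [BorelSpace V] {ν : Measure V} [IsFiniteMeasure ν] {N : V → ℝ}

/-- The marginals of a measure in all directions agree up to the scaling by `N`. -/
def HasScaledMarginals (ν : Measure V) (N : V → ℝ) : Prop :=
  ∀ ξ η, ξ ≠ 0 → η ≠ 0 → ν.map (fun x => ⟪x, ξ⟫_ℝ / N ξ) = ν.map (fun x => ⟪x, η⟫_ℝ / N η)

/-- The characteristic function of the rescaled marginal at `t` is `φ |t|`, whatever the direction.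
-/
theorem hasScaledMarginals_of_charFun {φ : ℝ → ℂ} (hφ : ∀ x, charFun ν x = φ (N x))
    (hpos : ∀ x, x ≠ 0 → 0 < N x) (hhom : ∀ (t : ℝ) x, N (t • x) = |t| * N x) :
    HasScaledMarginals ν N := by
  have key (ξ : V) (hξ : ξ ≠ 0) (t : ℝ) :
      charFun (ν.map (fun x => ⟪x, ξ⟫_ℝ / N ξ)) t = φ |t| := by
    have h := hφ ((t / N ξ) • ξ)
    rw [hhom, abs_div, abs_of_pos (hpos ξ hξ), div_mul_cancel₀ _ (hpos ξ hξ).ne'] at h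
    rw [← h, charFun_apply, charFun_apply, integral_map (by fun_prop)
      (Continuous.aestronglyMeasurable (by fun_prop))]
    congr with x
    rw [real_inner_smul_right]
    congr 3
    simp
    ring
  exact fun ξ η hξ hη => Measure.ext_of_charFun (funext fun t => by rw [key ξ hξ, key η hη])

/-- By Fubini's theorem the hyperplane orthogonal to a Gaussian-almost every `η` is `ν`-null, and
equality of the scaled marginals carries this from one such `η` to every `ξ`. -/
theorem HasScaledMarginals.ae_inner_ne_zero [Nontrivial V] (h : HasScaledMarginals ν N)
    (hpos : ∀ x, x ≠ 0 → 0 < N x) (h0 : ∀ᵐ x ∂ν, x ≠ 0) {ξ : V} (hξ : ξ ≠ 0) :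
    ∀ᵐ x ∂ν, ⟪x, ξ⟫_ℝ ≠ 0 := by
  have hms : MeasurableSet {p : V × V | ⟪p.1, p.2⟫_ℝ ≠ 0} :=
    (isOpen_ne_fun (by fun_prop) (by fun_prop)).measurableSet
  have h1 : ∀ᵐ x ∂ν, ∀ᵐ η ∂(stdGaussian V), ⟪x, η⟫_ℝ ≠ 0 :=
    h0.mono fun x hx => stdGaussian_ae_inner_ne_zero hx
  have h2 := (Measure.ae_ae_comm hms).1 h1
  obtain ⟨η, hη, hη0⟩ := (h2.and stdGaussian_ae_ne_zero).exists
  have h3 : ∀ᵐ t ∂(ν.map (fun x => ⟪x, η⟫_ℝ / N η)), t ≠ 0 := by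
    refine (ae_map_iff (by fun_prop) (measurableSet_singleton (0 : ℝ)).compl).2 ?_
    filter_upwards [hη] with x hx
    exact div_ne_zero hx (hpos η hη0).ne'
  rw [h η ξ hη0 hξ] at h3
  filter_upwards [ae_of_ae_map (by fun_prop) h3] with x hx h4
  exact hx (by rw [h4, zero_div])

theorem HasScaledMarginals.integral_comp_log_inner [Nontrivial V] (h : HasScaledMarginals ν N)
    (hpos : ∀ x, x ≠ 0 → 0 < N x) (h0 : ∀ᵐ x ∂ν, x ≠ 0) {ξ η : V} (hξ : ξ ≠ 0) (hη : η ≠ 0)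
    {φ : ℝ → ℝ} (hφ : Measurable φ) :
    ∫ x, φ (Real.log ⟪x, ξ⟫_ℝ) ∂ν =
      ∫ x, φ (Real.log ⟪x, η⟫_ℝ + (Real.log (N ξ) - Real.log (N η))) ∂ν := by
  have hm : Measurable (fun s : ℝ => φ (Real.log s + Real.log (N ξ))) := by fun_prop
  have e1 : ∫ x, φ (Real.log ⟪x, ξ⟫_ℝ) ∂ν = ∫ s, φ (Real.log s + Real.log (N ξ))
      ∂(ν.map (fun x => ⟪x, ξ⟫_ℝ / N ξ)) := by
    rw [integral_map (by fun_prop) hm.aestronglyMeasurable]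
    refine integral_congr_ae ?_
    filter_upwards [h.ae_inner_ne_zero hpos h0 hξ] with x hx
    rw [Real.log_div hx (hpos ξ hξ).ne', sub_add_cancel]
  rw [e1, h ξ η hξ hη, integral_map (by fun_prop) hm.aestronglyMeasurable]
  refine integral_congr_ae ?_
  filter_upwards [h.ae_inner_ne_zero hpos h0 hη] with x hx
  rw [Real.log_div hx (hpos η hη).ne']
  congr 1
  ring

theorem HasScaledMarginals.integral_clamp_log_inner_le [Nontrivial V]
    (h : HasScaledMarginals ν N) (hpos : ∀ x, x ≠ 0 → 0 < N x) (h0 : ∀ᵐ x ∂ν, x ≠ 0)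
    {ξ η : V} (hξ : ξ ≠ 0) (hη : η ≠ 0) (T : ℕ) :
    ∫ x, clamp T (Real.log ⟪x, η⟫_ℝ) ∂ν - ∫ x, clamp T (Real.log ⟪x, ξ⟫_ℝ) ∂ν ≤
      ν.real Set.univ * |Real.log (N ξ) - Real.log (N η)| := by
  have hm : Measurable fun x : V => Real.log ⟪x, η⟫_ℝ := by fun_prop
  have hi := hm.integrable_clamp (μ := ν) T
  have hi' := (hm.add_const (Real.log (N ξ) - Real.log (N η))).integrable_clamp (μ := ν) T
  rw [h.integral_comp_log_inner hpos h0 hξ hη (continuous_clamp T).measurable,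
    ← integral_sub hi hi', ← smul_eq_mul, ← integral_const]
  refine integral_mono (hi.sub hi') (integrable_const _) fun x => ?_
  refine (le_abs_self _).trans ((abs_clamp_sub_clamp_le T _ _).trans_eq ?_)
  rw [sub_add_cancel_left, abs_neg]

/-- By Cauchy–Schwarz, `ln ‖x‖ + ln ‖ξ‖ - ln |⟪x, ξ⟫|` is nonnegative, so it suffices to bound its
truncated integrals. -/
theorem HasScaledMarginals.integrable_log_inner_sub_log_norm [Nontrivial V]
    (h : HasScaledMarginals ν N) (hpos : ∀ x, x ≠ 0 → 0 < N x) (h0 : ∀ᵐ x ∂ν, x ≠ 0)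
    {ξ : V} (hξ : ξ ≠ 0) : Integrable (fun x => Real.log ⟪x, ξ⟫_ℝ - Real.log ‖x‖) ν := by
  obtain ⟨η, hη, hηi⟩ := exists_integrable_log_inner_sub_log_norm h0
  have hmξ : Measurable fun x : V => Real.log ⟪x, ξ⟫_ℝ := by fun_prop
  have hmη : Measurable fun x : V => Real.log ⟪x, η⟫_ℝ := by fun_prop
  have hmn : Measurable fun x : V => Real.log ‖x‖ + Real.log ‖ξ‖ := by fun_prop
  have hd : Integrable (fun x => (Real.log ‖x‖ + Real.log ‖ξ‖) - Real.log ⟪x, η⟫_ℝ) ν := by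
    refine ((integrable_const (Real.log ‖ξ‖)).sub hηi).congr (ae_of_all _ fun x => ?_)
    simp only [Pi.sub_apply]
    ring
  -- The bound goes through `ln |⟪x, η⟫|`: the first summand uses the integrability known for `η`,
  -- the second the change of direction from `η` to `ξ`.
  have key := integrable_sub_of_integral_clamp_le (μ := ν) hmn hmξ ?_
    (∫ x, |(Real.log ‖x‖ + Real.log ‖ξ‖) - Real.log ⟪x, η⟫_ℝ| ∂ν +
      ν.real Set.univ * |Real.log (N ξ) - Real.log (N η)|) ?_
  · refine ((integrable_const (Real.log ‖ξ‖)).sub key).congr (ae_of_all _ fun x => ?_)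
    simp only [Pi.sub_apply]
    ring
  · filter_upwards [h0, h.ae_inner_ne_zero hpos h0 hξ] with x hx hxξ
    rw [← Real.log_mul (norm_ne_zero_iff.2 hx) (norm_ne_zero_iff.2 hξ), ← Real.log_abs ⟪x, ξ⟫_ℝ]
    exact Real.log_le_log (abs_pos.2 hxξ) (abs_real_inner_le_norm x ξ)
  · intro T
    have h1 := h.integral_clamp_log_inner_le hpos h0 hξ hη T
    have h2 : ∫ x, clamp T (Real.log ‖x‖ + Real.log ‖ξ‖) ∂ν -
        ∫ x, clamp T (Real.log ⟪x, η⟫_ℝ) ∂ν ≤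
        ∫ x, |(Real.log ‖x‖ + Real.log ‖ξ‖) - Real.log ⟪x, η⟫_ℝ| ∂ν := by
      rw [← integral_sub (hmn.integrable_clamp T) (hmη.integrable_clamp T)]
      exact integral_mono ((hmn.integrable_clamp T).sub (hmη.integrable_clamp T)) hd.abs
        fun x => (le_abs_self _).trans (abs_clamp_sub_clamp_le T _ _)
    linarith

/-- The terms `ln ‖x‖` cancel, leaving the difference of two logarithms whose laws are translates of
each other. -/
theorem HasScaledMarginals.integral_log_inner_sub_log_norm [Nontrivial V]
    (h : HasScaledMarginals ν N) (hpos : ∀ x, x ≠ 0 → 0 < N x) (h0 : ∀ᵐ x ∂ν, x ≠ 0)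
    {ξ η : V} (hξ : ξ ≠ 0) (hη : η ≠ 0) :
    ∫ x, (Real.log ⟪x, ξ⟫_ℝ - Real.log ‖x‖) ∂ν - ∫ x, (Real.log ⟪x, η⟫_ℝ - Real.log ‖x‖) ∂ν =
      ν.real Set.univ * (Real.log (N ξ) - Real.log (N η)) := by
  have hmξ : Measurable fun x : V => Real.log ⟪x, ξ⟫_ℝ := by fun_prop
  have hmη : Measurable fun x : V => Real.log ⟪x, η⟫_ℝ := by fun_prop
  have hiξ := h.integrable_log_inner_sub_log_norm hpos h0 hξ
  have hiη := h.integrable_log_inner_sub_log_norm hpos h0 hη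
  have hd : Integrable (fun x => Real.log ⟪x, ξ⟫_ℝ - Real.log ⟪x, η⟫_ℝ) ν :=
    (hiξ.sub hiη).congr (ae_of_all _ fun x => by simp)
  have l1 := tendsto_integral_clamp_sub_clamp hmξ hmη hd
  -- By equality of laws, these truncated differences form the same sequence as in `l1`, but here
  -- the untruncated difference is a constant.
  have l2 := tendsto_integral_clamp_sub_clamp (μ := ν)
    (hmη.add_const (Real.log (N ξ) - Real.log (N η))) hmη (by simp)
  simp only [← h.integral_comp_log_inner hpos h0 hξ hη (continuous_clamp _).measurable,
    add_sub_cancel_left, integral_const, smul_eq_mul] at l2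
  rw [← tendsto_nhds_unique l1 l2, ← integral_sub hiξ hiη]
  simp

end Scaling

/-! ### The gauge, projection to the sphere, and the conclusion. -/

theorem IsStarBody.gauge_pos {n : ℕ} {K : Set (EuclideanSpace ℝ (Fin n))} (hK : IsStarBody K)
    {x : EuclideanSpace ℝ (Fin n)} (hx : x ≠ 0) : 0 < gauge K x :=
  (_root_.gauge_pos (absorbent_nhds_zero (mem_interior_iff_mem_nhds.1 hK.zero_mem_interior))
    (NormedSpace.isVonNBounded_of_isBounded _ hK.isBounded)).2 hx

theorem IsOriginSymmetric.gauge_smul {n : ℕ} {K : Set (EuclideanSpace ℝ (Fin n))}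
    (hK : IsOriginSymmetric K) (t : ℝ) (x : EuclideanSpace ℝ (Fin n)) :
    gauge K (t • x) = |t| * gauge K x := by
  rcases le_total 0 t with ht | ht
  · rw [gauge_smul_of_nonneg ht, abs_of_nonneg ht, smul_eq_mul]
  · rw [abs_of_nonpos ht, ← smul_eq_mul, ← gauge_smul_of_nonneg (neg_nonneg.2 ht), neg_smul,
      gauge_neg hK]

theorem charFun_restrict_compl_zero {V : Type*} [NormedAddCommGroup V] [InnerProductSpace ℝ V]
    [MeasurableSpace V] [BorelSpace V] [SecondCountableTopology V] (ν : Measure V)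
    [IsFiniteMeasure ν] (x : V) :
    charFun (ν.restrict {0}ᶜ) x = charFun ν x - (ν.real {0} : ℂ) := by
  have hi : Integrable (fun y => Complex.exp (⟪y, x⟫_ℝ * Complex.I)) ν :=
    Integrable.of_bound (Continuous.aestronglyMeasurable (by fun_prop)) 1
      (ae_of_all _ fun y => (Complex.norm_exp_ofReal_mul_I _).le)
  have h := integral_add_compl (measurableSet_singleton (0 : V)) hi
  rw [integral_singleton] at h
  simp only [charFun_apply, ← h]
  simp

/-- Radial projection to the unit sphere of a measure with `ν {0} = 0`. -/
theorem exists_sphere_measure {V : Type*} [NormedAddCommGroup V] [InnerProductSpace ℝ V]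
    [MeasurableSpace V] [BorelSpace V] [SecondCountableTopology V] (ν : Measure V)
    [IsFiniteMeasure ν] (h0 : ∀ᵐ x ∂ν, x ≠ 0) :
    ∃ μ : Measure (Metric.sphere (0 : V) 1), IsFiniteMeasure μ ∧
      μ.map Subtype.val = ν.map (fun x => ‖x‖⁻¹ • x) := by
  have hs : MeasurableSet (Metric.sphere (0 : V) 1) := Metric.isClosed_sphere.measurableSet
  have hm : Measurable (fun x : V => ‖x‖⁻¹ • x) := by fun_prop
  have he := MeasurableEmbedding.subtype_coe hs
  have hmap : ((ν.map (fun x => ‖x‖⁻¹ • x)).comap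
      (Subtype.val : Metric.sphere (0 : V) 1 → V)).map Subtype.val =
      ν.map (fun x => ‖x‖⁻¹ • x) := by
    rw [map_comap_subtype_coe hs, Measure.restrict_eq_self_of_ae_mem]
    refine (ae_map_iff hm.aemeasurable hs).2 ?_
    filter_upwards [h0] with x hx
    simpa using norm_smul_inv_norm (𝕜 := ℝ) hx
  refine ⟨_, ⟨?_⟩, hmap⟩
  have h1 := congr_arg (fun m => m Set.univ) hmap
  simp only [Measure.map_apply measurable_subtype_coe MeasurableSet.univ, Set.preimage_univ] at h1
  rw [h1]
  exact measure_lt_top _ _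

theorem HasScaledMarginals.embedsInL0 {n : ℕ} [Nontrivial (EuclideanSpace ℝ (Fin n))]
    {ν : Measure (EuclideanSpace ℝ (Fin n))} [IsFiniteMeasure ν] (hν : ν ≠ 0)
    {N : EuclideanSpace ℝ (Fin n) → ℝ} (h : HasScaledMarginals ν N)
    (hpos : ∀ x, x ≠ 0 → 0 < N x) (h0 : ∀ᵐ x ∂ν, x ≠ 0) : EmbedsInL0 N := by
  obtain ⟨μ, hμ, hmap⟩ := exists_sphere_measure ν h0
  have hm : Measurable (fun x : EuclideanSpace ℝ (Fin n) => ‖x‖⁻¹ • x) := by fun_prop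
  have hms : Measurable (Subtype.val : Metric.sphere (0 : EuclideanSpace ℝ (Fin n)) 1 → _) :=
    measurable_subtype_coe
  obtain ⟨η, hη⟩ := exists_ne (0 : EuclideanSpace ℝ (Fin n))
  have hM0 : ν Set.univ ≠ 0 := by simpa using hν
  have hM : 0 < ν.real Set.univ := ENNReal.toReal_pos hM0 (measure_ne_top _ _)
  have hae (x : EuclideanSpace ℝ (Fin n)) (hx : x ≠ 0) :
      ∀ᵐ y ∂ν, Real.log |⟪x, ‖y‖⁻¹ • y⟫_ℝ| = Real.log ⟪y, x⟫_ℝ - Real.log ‖y‖ := by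
    filter_upwards [h0, h.ae_inner_ne_zero hpos h0 hx] with y hy hyx
    rw [Real.log_abs, real_inner_comm, inner_inv_norm_smul,
      Real.log_div hyx (norm_ne_zero_iff.2 hy)]
  have hlm (x : EuclideanSpace ℝ (Fin n)) : Measurable fun y => Real.log |⟪x, y⟫_ℝ| := by fun_prop
  have hint (x : EuclideanSpace ℝ (Fin n)) (hx : x ≠ 0) :
      Integrable (fun ξ : Metric.sphere (0 : EuclideanSpace ℝ (Fin n)) 1 =>
        Real.log |⟪x, (ξ : EuclideanSpace ℝ (Fin n))⟫_ℝ|) μ := by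
    refine (integrable_map_measure (hlm x).aestronglyMeasurable hms.aemeasurable).1 ?_
    rw [hmap, integrable_map_measure (hlm x).aestronglyMeasurable hm.aemeasurable]
    exact (integrable_congr (hae x hx)).2 (h.integrable_log_inner_sub_log_norm hpos h0 hx)
  have hval (x : EuclideanSpace ℝ (Fin n)) (hx : x ≠ 0) :
      ∫ ξ, Real.log |⟪x, (ξ : EuclideanSpace ℝ (Fin n))⟫_ℝ| ∂μ =
        ∫ y, (Real.log ⟪y, x⟫_ℝ - Real.log ‖y‖) ∂ν := by
    rw [← integral_map hms.aemeasurable (hlm x).aestronglyMeasurable, hmap,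
      integral_map hm.aemeasurable (hlm x).aestronglyMeasurable]
    exact integral_congr_ae (hae x hx)
  -- Dividing by the mass makes the coefficient of `log (N x)` equal to one; the constant is fixed
  -- by the reference direction `η`.
  refine ⟨(ν Set.univ)⁻¹ • μ, Real.log (N η) -
    (ν.real Set.univ)⁻¹ * ∫ y, (Real.log ⟪y, η⟫_ℝ - Real.log ‖y‖) ∂ν,
    Measure.smul_finite _ (ENNReal.inv_ne_top.2 hM0), fun x hx => ⟨?_, ?_, ?_⟩⟩
  · refine Measure.ae_smul_measure ?_ _
    have h1 : ∀ᵐ y ∂(μ.map Subtype.val), ⟪x, y⟫_ℝ ≠ 0 := by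
      rw [hmap]
      refine (ae_map_iff hm.aemeasurable
        (isOpen_ne_fun (by fun_prop) (by fun_prop)).measurableSet).2 ?_
      filter_upwards [h0, h.ae_inner_ne_zero hpos h0 hx] with y hy hyx
      rw [real_inner_comm, inner_inv_norm_smul]
      exact div_ne_zero hyx (norm_ne_zero_iff.2 hy)
    exact ae_of_ae_map hms.aemeasurable h1
  · exact (hint x hx).smul_measure (ENNReal.inv_ne_top.2 hM0)
  · rw [integral_smul_measure, hval x hx, ENNReal.toReal_inv, smul_eq_mul]
    have := h.integral_log_inner_sub_log_norm hpos h0 hx hη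
    rw [sub_eq_iff_eq_add] at this
    change _ = (ν.real Set.univ)⁻¹ * _ + _
    rw [this]
    field_simp
    ring

theorem theorem1 (n : ℕ) (hn : 2 ≤ n) (K : Set (EuclideanSpace ℝ (Fin n)))
    (hK : IsStarBody K) (hsymm : IsOriginSymmetric K)
    (hf : ∃ f : ℝ → ℝ, (∀ t, f (-t) = f t) ∧ Continuous f ∧ (¬ ∃ c : ℝ, ∀ t, f t = c) ∧
      IsPosDefFun (fun x : EuclideanSpace ℝ (Fin n) => ((f (gauge K x) : ℝ) : ℂ))) :
    EmbedsInL0 (fun x : EuclideanSpace ℝ (Fin n) => gauge K x) := by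
  obtain ⟨f, hev, hfc, hnc, hpd⟩ := hf
  have : Nonempty (Fin n) := ⟨⟨0, by omega⟩⟩
  have hgc := hK.continuous_gauge
  obtain ⟨ν, hν, hchar⟩ := hpd.exists_charFun_eq (by fun_prop)
  have hchar' (x : EuclideanSpace ℝ (Fin n)) : charFun (ν.restrict {0}ᶜ) x =
      (fun t : ℝ => (f t : ℂ) - (ν.real {0} : ℂ)) (gauge K x) := by
    rw [charFun_restrict_compl_zero, hchar]
  have h := hasScaledMarginals_of_charFun (ν := ν.restrict {0}ᶜ) (N := gauge K)
    (φ := fun t : ℝ => (f t : ℂ) - (ν.real {0} : ℂ)) hchar' (fun x => hK.gauge_pos) hsymm.gauge_smul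
  -- If nothing remained off the origin, `f` would be constant on the values of the gauge. These
  -- fill `[0, ∞)` along any line through the origin, and evenness covers the negative reals.
  refine h.embedsInL0 (fun hzero => hnc ⟨ν.real {0}, ?_⟩) (fun x => hK.gauge_pos) ?_
  · have hconst (x : EuclideanSpace ℝ (Fin n)) : f (gauge K x) = ν.real {0} := by
      have := hchar' x
      rw [hzero, charFun_zero_measure] at this
      exact_mod_cast (sub_eq_zero.1 this.symm)
    obtain ⟨x, hx⟩ := exists_ne (0 : EuclideanSpace ℝ (Fin n))
    have habs (t : ℝ) : f |t| = f t := by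
      rcases abs_choice t with h | h <;> rw [h]
      exact hev t
    intro t
    have := hconst ((t / gauge K x) • x)
    rwa [hsymm.gauge_smul, abs_div, abs_of_pos (hK.gauge_pos hx),
      div_mul_cancel₀ _ (hK.gauge_pos hx).ne', habs] at this
  · exact ae_restrict_mem (measurableSet_singleton 0).compl
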